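/- Let $k\ge 1$ and let $A\in\mathbb R^{k\times k}$ be symmetric and positive definite. Let $(N(n))_n$ be a strictly increasing sequence of natural numbers and, for each $n$, let $\{1,\dots,N(n)\}$ be partitioned into $k$ blocks $B^{(n)}_1,\dots,B^{(n)}_k$. Assume that for each $i$ the limit $$\gamma_i=\lim_{n\to\infty}\sqrt{|B^{(n)}_i|/N(n)}$$ exists and is positive, and put $\Gamma_\infty=\operatorname{diag}(\gamma_1,\dots,\gamma_k)$. With $N=N(n)$, let $\mu_{J_n}$ be the block spin Ising model, i.e. the probability measure on $\{-1,+1\}^{N}$ given by $$\mu_{J_n}(x)=Z_n^{-1}\exp\Big(\tfrac12\sum_{u,v=1}^{N}(J_n)_{uv}x_ux_v\Big),\qquad (J_n)_{uv}=\tfrac1N A_{ij}\ \text{ for } u\in B^{(n)}_i,\ v\in B^{(n)}_j,$$ where $Z_n$ is the normalizing constant, and let $$\widehat m^{(n)}(x)=\Big(|B^{(n)}_i|^{-1/2}\sum_{v\in B^{(n)}_i}x_v\Big)_{i=1,\dots,k}$$ be the scaled block magnetization vector (a component belonging to an empty block is set to $0$; no block is empty once $n$ is large). Write $\|\cdot\|_{2\to2}$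 for the operator norm with respect to the Euclidean norm. (1) If $\|\Gamma_\infty A\Gamma_\infty\|_{2\to2}<1$ (strict high temperature regime), then $\mathrm{Id}-\Gamma_\infty A\Gamma_\infty$ is positive definite and, under $\mu_{J_n}$, $$\widehat m^{(n)}\Rightarrow\mathcal N\big(0,(\mathrm{Id}-\Gamma_\infty A\Gamma_\infty)^{-1}\big)\qquad(n\to\infty).$$ (2) Consequently, in the uniform case $\gamma_1=\dots=\gamma_k=1/\sqrt k$, in which the regime is $\|A\|_{2\to2}<k$, under this condition $\mathrm{Id}-\frac1kA$ is positive definite and, under $\mu_{J_n}$, $$\widehat m^{(n)}\Rightarrow\mathcal N\big(0,(\mathrm{Id}-\tfrac1kA)^{-1}\big)\qquad(n\to\infty).$$ Here $\Rightarrow$ denotes convergence in distribution. -/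

import Mathlib

open MeasureTheory ProbabilityTheory Filter Topology

namespace BlockSpin

noncomputable section

/-- Spin configurations: functions on the sites with values in `{-1, +1}` (the units of `ℤ`). -/
abbrev SpinConfig (V : Type*) : Type _ := V → ℤˣ

/-- The measurable space of `{-1, +1}` is discrete. -/
instance : MeasurableSingletonClass ℤˣ where
  measurableSet_singleton a :=
    ⟨{(a : ℤ)}, MeasurableSet.of_discrete, by ext c; simp [Units.ext_iff]⟩

/-- The spin at a site, as a real number. -/
def spin {V : Type*} (x : SpinConfig V) (v : V) : ℝ := ((x v : ℤ) : ℝ)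

/-- The Hamiltonian `H(x) = 1/2 ∑ i j, J i j * x i * x j`. -/
def hamiltonian {V : Type*} [Fintype V] (J : Matrix V V ℝ) (x : SpinConfig V) : ℝ :=
  (1 / 2) * ∑ i, ∑ j, J i j * spin x i * spin x j

/-- The partition function. -/
def partitionFunction {V : Type*} [Fintype V] [DecidableEq V] (J : Matrix V V ℝ) : ℝ :=
  ∑ x : SpinConfig V, Real.exp (hamiltonian J x)

theorem partitionFunction_pos {V : Type*} [Fintype V] [DecidableEq V] (J : Matrix V V ℝ) :
    0 < partitionFunction J :=
  Finset.sum_pos (fun _ _ => Real.exp_pos _) Finset.univ_nonempty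

theorem sum_gibbs_weight {V : Type*} [Fintype V] [DecidableEq V] (J : Matrix V V ℝ) :
    ∑ x : SpinConfig V,
      ENNReal.ofReal (Real.exp (hamiltonian J x) / partitionFunction J) = 1 := by
  have hZ := partitionFunction_pos J
  rw [← ENNReal.ofReal_sum_of_nonneg (fun x _ => by positivity), ← Finset.sum_div]
  change ENNReal.ofReal (partitionFunction J / partitionFunction J) = 1
  rw [div_self hZ.ne', ENNReal.ofReal_one]

/-- The Ising model with interaction matrix `J`, as a probability mass function:
`x` has mass `exp (H x) / Z`. -/
def isingPMF {V : Type*} [Fintype V] [DecidableEq V] (J : Matrix V V ℝ) : PMF (SpinConfig V) :=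
  PMF.ofFintype
    (fun x => ENNReal.ofReal (Real.exp (hamiltonian J x) / partitionFunction J))
    (sum_gibbs_weight J)

/-- The Ising model with interaction matrix `J`, as a probability measure. -/
def isingMeasure {V : Type*} [Fintype V] [DecidableEq V] (J : Matrix V V ℝ) :
    Measure (SpinConfig V) :=
  (isingPMF J).toMeasure

instance {V : Type*} [Fintype V] [DecidableEq V] (J : Matrix V V ℝ) :
    IsProbabilityMeasure (isingMeasure J) :=
  PMF.toMeasure.isProbabilityMeasure _

/-- A partition of `N` sites into `k` blocks is given by the map `b` sending each site to the
label of its block; `block b i` is the `i`-th block. -/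
def block {N k : ℕ} (b : Fin N → Fin k) (i : Fin k) : Finset (Fin N) :=
  {v | b v = i}

/-- The interaction matrix with entry `A i j / N` at a pair of sites lying in the blocks
`i` and `j`. -/
def blockInteraction {N k : ℕ} (A : Matrix (Fin k) (Fin k) ℝ) (b : Fin N → Fin k) :
    Matrix (Fin N) (Fin N) ℝ :=
  Matrix.of fun u v => (1 / (N : ℝ)) * A (b u) (b v)

/-- The scaled block magnetization vector
`(|B i| ^ (-1/2) * ∑ v ∈ B i, x v) i`. -/
def scaledMagnetization {N k : ℕ} (b : Fin N → Fin k) (x : SpinConfig (Fin N)) :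
    EuclideanSpace ℝ (Fin k) :=
  WithLp.toLp 2 fun i => (1 / √((block b i).card : ℝ)) * ∑ v ∈ block b i, spin x v

/-- The operator norm of a real square matrix with respect to the Euclidean norm. -/
def opNorm {k : ℕ} (M : Matrix (Fin k) (Fin k) ℝ) : ℝ :=
  ‖Matrix.toEuclideanCLM (n := Fin k) (𝕜 := ℝ) M‖

end

end BlockSpin

open scoped Matrix

namespace BlockSpin

/-! By Lévy's continuity theorem it suffices to find the limit of the characteristic functions.
Write `A = L * Lᵀ`. The Hamiltonian is then half a sum of `k` squares of linear forms in the spins,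
and the Hubbard–Stratonovich identity makes `exp H` a standard Gaussian average over `v ∈ ℝ^k` of
exponentials of linear forms. Given `v` the spins decouple, and the Fourier-weighted partition sum
becomes a Gaussian integral of `∏ i, cosh (z_i) ^ |B_i|` with `z_i = (L v)_i / √N + I t_i / √|B_i|`
(`sum_exp_hamiltonian_mul_exp_inner`).

With `Γ = diag γ` and `W = Γ L`, `√|B_i| z_i → (W v)_i + I t_i`, so each factor tends to `exp (((W
v)_i + I t_i)² / 2)` (`tendsto_cosh_pow`). The limiting integrand is Gaussian with quadratic form `1
- Wᵀ W`. Choosing `W` with `W Wᵀ = Γ A Γ` and `Wᵀ W = diag d` splits it into one-dimensional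
integrals, which converge because the high temperature condition forces `d j < 1`. The strict
inequality also leaves room for an integrable majorant (`tendsto_integral_prod_cosh`). The limit is
a constant times `exp (-t·(1 - Γ A Γ)⁻¹ t / 2)`, and dividing by its value at `t = 0` removes the
constant. -/

/-! ### Bounds and asymptotics for the complex hyperbolic cosine -/

theorem norm_cosh_le_exp (z : ℂ) : ‖Complex.cosh z‖ ≤ Real.exp (z.re ^ 2 / 2) := by
  refine le_trans ?_ (Real.cosh_le_exp_half_sq z.re)
  rw [Complex.cosh, norm_div, Real.cosh_eq]
  have h := norm_add_le (Complex.exp z) (Complex.exp (-z))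
  rw [Complex.norm_exp, Complex.norm_exp, Complex.neg_re] at h
  simpa using div_le_div_of_nonneg_right h (zero_le_two)

/-- The factorization `f w = w * dslope f 0 w` replaces the difference quotient, so `w n` is allowed
to vanish. -/
theorem tendsto_mul_comp_of_hasDerivAt {f : ℂ → ℂ} {a z : ℂ} (hf : HasDerivAt f a 0)
    (h0 : f 0 = 0) {c w : ℕ → ℂ} (hw : Tendsto w atTop (𝓝 0))
    (hcw : Tendsto (fun n => c n * w n) atTop (𝓝 z)) :
    Tendsto (fun n => c n * f (w n)) atTop (𝓝 (z * a)) := by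
  have hcont : ContinuousAt (dslope f 0) 0 := continuousAt_dslope_same.2 hf.differentiableAt
  have h1 : Tendsto (fun n => dslope f 0 (w n)) atTop (𝓝 a) := by
    have := hcont.tendsto.comp hw
    rwa [dslope_same, hf.deriv] at this
  refine (hcw.mul h1).congr fun n => ?_
  have h2 := sub_smul_dslope f 0 (w n)
  rw [h0, sub_zero, sub_zero, smul_eq_mul] at h2
  rw [← h2, mul_assoc]

/-- If `√p * w → z` and `p → ∞`, then `cosh w ^ p → exp (z ^ 2 / 2)`. -/
theorem tendsto_cosh_pow {p : ℕ → ℕ} {w : ℕ → ℂ} {z : ℂ} (hp : Tendsto p atTop atTop)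
    (hw : Tendsto (fun n => ((√(p n : ℝ) : ℝ) : ℂ) * w n) atTop (𝓝 z)) :
    Tendsto (fun n => Complex.cosh (w n) ^ p n) atTop (𝓝 (Complex.exp (z ^ 2 / 2))) := by
  have hsq : ∀ n, ((√(p n : ℝ) : ℝ) : ℂ) * ((√(p n : ℝ) : ℝ) : ℂ) = (p n : ℂ) := fun n => by
    rw [← Complex.ofReal_mul, Real.mul_self_sqrt (Nat.cast_nonneg _), Complex.ofReal_natCast]
  have hs : Tendsto (fun n => √(p n : ℝ)) atTop atTop :=
    Real.tendsto_sqrt_atTop.comp (tendsto_natCast_atTop_atTop.comp hp)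
  have hsi : Tendsto (fun n => (((√(p n : ℝ))⁻¹ : ℝ) : ℂ)) atTop (𝓝 0) := by
    rw [← Complex.ofReal_zero]
    exact (Complex.continuous_ofReal.tendsto _).comp (tendsto_inv_atTop_zero.comp hs)
  have hspos : ∀ᶠ n in atTop, 0 < √(p n : ℝ) := hs.eventually_gt_atTop 0
  have hw0 : Tendsto w atTop (𝓝 0) := by
    have h := hsi.mul hw
    rw [zero_mul] at h
    refine h.congr' ?_
    filter_upwards [hspos] with n hn
    rw [Complex.ofReal_inv, inv_mul_cancel_left₀ (Complex.ofReal_ne_zero.2 hn.ne')]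
  have hsinh := tendsto_mul_comp_of_hasDerivAt (f := Complex.sinh) (a := 1)
    (c := fun n => ((√(p n : ℝ) : ℝ) : ℂ)) (w := fun n => w n / 2) (z := z / 2)
    (by simpa using Complex.hasDerivAt_sinh 0) Complex.sinh_zero
    (by simpa using hw0.div_const 2) (by simpa [mul_div_assoc] using hw.div_const 2)
  -- The half-angle formula reduces the second-order behaviour of `cosh` at `0` to the first-order
  -- behaviour of `sinh`.
  have hcosh : ∀ n, Complex.cosh (w n) - 1 = 2 * (Complex.sinh (w n / 2)) ^ 2 := fun n => by
    have h := Complex.cosh_two_mul (w n / 2)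
    rw [mul_div_cancel₀ (w n) two_ne_zero, Complex.cosh_sq] at h
    rw [h]; ring
  have hg : Tendsto (fun n => (p n : ℂ) * (Complex.cosh (w n) - 1)) atTop (𝓝 (z ^ 2 / 2)) := by
    have h := (hsinh.pow 2).const_mul 2
    rw [show 2 * (z / 2 * 1) ^ 2 = z ^ 2 / 2 by ring] at h
    refine h.congr fun n => ?_
    rw [hcosh, ← hsq]; ring
  have hg0 : Tendsto (fun n => Complex.cosh (w n) - 1) atTop (𝓝 0) := by
    have := ((Complex.continuous_cosh.tendsto 0).comp hw0).sub_const 1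
    simpa using this
  have hlog := tendsto_mul_comp_of_hasDerivAt (f := fun u => Complex.log (1 + u)) (a := 1)
    (c := fun n => (p n : ℂ)) (w := fun n => Complex.cosh (w n) - 1)
    (by
      have h := (Complex.hasDerivAt_log (z := 1) Complex.one_mem_slitPlane)
      have h' : HasDerivAt (fun u : ℂ => 1 + u) 1 0 := (hasDerivAt_id 0).const_add 1
      have h'' := HasDerivAt.comp (h₂ := Complex.log) (0 : ℂ) (by simpa using h) h'
      simpa [Function.comp_def] using h'')
    (by simp) hg0 hg
  rw [mul_one] at hlog
  refine ((Complex.continuous_exp.tendsto _).comp hlog).congr' ?_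
  -- No branch question arises: `exp (p * log c) = c ^ p` for natural `p` needs only `c ≠ 0`.
  have hne : ∀ᶠ n in atTop, Complex.cosh (w n) - 1 ≠ -1 :=
    hg0.eventually_ne (by simp)
  filter_upwards [hne] with n hn
  have hc : Complex.cosh (w n) ≠ 0 := fun h => hn (by rw [h]; ring)
  simp only [Function.comp_apply]
  rw [add_sub_cancel, Complex.exp_nat_mul, Complex.exp_log hc]

/-! ### Linearization of the Hamiltonian -/

/-- The generating function of independent uniform spins. -/
theorem sum_prod_exp_spin {V : Type*} [Fintype V] [DecidableEq V] (f : V → ℂ) :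
    ∑ x : SpinConfig V, ∏ v, Complex.exp (f v * spin x v) = ∏ v, 2 * Complex.cosh (f v) := by
  have h := Finset.prod_univ_sum (fun _ : V => (Finset.univ : Finset ℤˣ))
    (fun v s => Complex.exp (f v * (((s : ℤ) : ℝ) : ℂ)))
  rw [Fintype.piFinset_univ] at h
  refine h.symm.trans (Finset.prod_congr rfl fun v _ => ?_)
  rw [Complex.two_cosh, show (Finset.univ : Finset ℤˣ) = {1, -1} from rfl,
    Finset.sum_pair (by decide)]
  simp

/-- If `A = L * Lᵀ`, the Hamiltonian of the block interaction is half a sum of squares. -/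
theorem hamiltonian_blockInteraction {N k : ℕ} (L : Matrix (Fin k) (Fin k) ℝ)
    (b : Fin N → Fin k) (x : SpinConfig (Fin N)) :
    hamiltonian (blockInteraction (L * L.transpose) b) x =
      ∑ j, (∑ u, L (b u) j / √(N : ℝ) * spin x u) ^ 2 / 2 := by
  have hN : (1 / (N : ℝ)) = (√(N : ℝ))⁻¹ * (√(N : ℝ))⁻¹ := by
    rw [← mul_inv, Real.mul_self_sqrt (Nat.cast_nonneg _), one_div]
  have hsq : ∀ j, (∑ u, L (b u) j / √(N : ℝ) * spin x u) ^ 2 / 2 =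
      ∑ u, ∑ v, (L (b u) j / √(N : ℝ) * spin x u) * (L (b v) j / √(N : ℝ) * spin x v) / 2 :=
    fun j => by rw [sq, Finset.sum_mul_sum, Finset.sum_div]; simp only [Finset.sum_div]
  rw [Finset.sum_congr rfl fun j _ => hsq j, Finset.sum_comm, hamiltonian, Finset.mul_sum]
  refine Finset.sum_congr rfl fun u _ => ?_
  rw [Finset.sum_comm, Finset.mul_sum]
  refine Finset.sum_congr rfl fun v _ => ?_
  simp only [blockInteraction, Matrix.of_apply, Matrix.mul_apply, Matrix.transpose_apply, hN,
    Finset.mul_sum, Finset.sum_mul]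
  refine Finset.sum_congr rfl fun j _ => ?_
  ring

/-- The normalizing constant of the standard Gaussian weight on `ℝ ^ k`. -/
noncomputable def gaussianConst (k : ℕ) : ℂ :=
  ∏ _i : Fin k, ((Real.pi : ℂ) / (1 / 2)) ^ (1 / 2 : ℂ)

theorem gaussianConst_ne_zero (k : ℕ) : gaussianConst k ≠ 0 := by
  refine Finset.prod_ne_zero_iff.2 fun i _ => ?_
  rw [Complex.cpow_ne_zero_iff]
  left
  simp [Real.pi_ne_zero]

theorem integral_cexp_standard {k : ℕ} (c : Fin k → ℂ) :
    ∫ v : Fin k → ℝ, Complex.exp (-∑ j, (1 / 2) * (v j : ℂ) ^ 2 + ∑ j, c j * v j) =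
      gaussianConst k * Complex.exp (∑ j, c j ^ 2 / 2) := by
  rw [GaussianFourier.integral_cexp_neg_sum_mul_add (fun _ => by norm_num), Finset.prod_mul_distrib,
    gaussianConst, Complex.exp_sum]
  congr 1
  refine Finset.prod_congr rfl fun j _ => ?_
  congr 1; ring

/-- The complex field acting on the spins of a block after linearizing the Hamiltonian. -/
noncomputable def blockField {N k : ℕ} (L : Matrix (Fin k) (Fin k) ℝ) (b : Fin N → Fin k)
    (t : EuclideanSpace ℝ (Fin k)) (v : Fin k → ℝ) (i : Fin k) : ℂ :=
  (((∑ j, L i j * v j) / √(N : ℝ) : ℝ) : ℂ) + ((t i / √((block b i).card : ℝ) : ℝ) : ℂ) * Complex.I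

theorem inner_scaledMagnetization {N k : ℕ} (b : Fin N → Fin k) (x : SpinConfig (Fin N))
    (t : EuclideanSpace ℝ (Fin k)) :
    inner ℝ (scaledMagnetization b x) t =
      ∑ u, t (b u) / √((block b (b u)).card : ℝ) * spin x u := by
  rw [PiLp.inner_apply, ← Finset.sum_fiberwise (s := Finset.univ) (g := b)]
  refine Finset.sum_congr rfl fun i _ => ?_
  simp only [scaledMagnetization, RCLike.inner_apply, conj_trivial]
  rw [← mul_assoc, Finset.mul_sum]
  refine Finset.sum_congr rfl fun u hu => ?_
  have : b u = i := by simpa [block] using hu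
  rw [this]; ring

/-- Hubbard–Stratonovich transform of the Fourier weights of the magnetization. -/
theorem sum_exp_hamiltonian_mul_exp_inner {N k : ℕ} (L : Matrix (Fin k) (Fin k) ℝ)
    (b : Fin N → Fin k) (t : EuclideanSpace ℝ (Fin k)) :
    gaussianConst k * ∑ x : SpinConfig (Fin N),
      Complex.exp (hamiltonian (blockInteraction (L * L.transpose) b) x) *
        Complex.exp (inner ℝ (scaledMagnetization b x) t * Complex.I) =
    2 ^ N * ∫ v : Fin k → ℝ, Complex.exp (-∑ j, (1 / 2) * (v j : ℂ) ^ 2) *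
      ∏ i, Complex.cosh (blockField L b t v i) ^ (block b i).card := by
  have h1 : ∀ x : SpinConfig (Fin N), gaussianConst k *
      (Complex.exp (hamiltonian (blockInteraction (L * L.transpose) b) x) *
        Complex.exp (inner ℝ (scaledMagnetization b x) t * Complex.I)) =
      ∫ v : Fin k → ℝ, Complex.exp (-∑ j, (1 / 2) * (v j : ℂ) ^ 2 + ∑ j,
        ((∑ u, L (b u) j / √(N : ℝ) * spin x u : ℝ) : ℂ) * v j) *
        Complex.exp (inner ℝ (scaledMagnetization b x) t * Complex.I) := fun x => by
    rw [integral_mul_const, integral_cexp_standard, hamiltonian_blockInteraction]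
    push_cast
    ring
  rw [Finset.mul_sum, Finset.sum_congr rfl fun x _ => h1 x, ← integral_finsetSum, ← integral_const_mul]
  swap
  · exact fun x _ => (GaussianFourier.integrable_cexp_neg_sum_mul_add
      (fun _ => by norm_num) _).mul_const _
  refine integral_congr_ae (ae_of_all _ fun v => ?_)
  have h2 : ∀ x : SpinConfig (Fin N), Complex.exp (-∑ j, (1 / 2) * (v j : ℂ) ^ 2 + ∑ j,
        ((∑ u, L (b u) j / √(N : ℝ) * spin x u : ℝ) : ℂ) * v j) *
        Complex.exp (inner ℝ (scaledMagnetization b x) t * Complex.I) =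
      Complex.exp (-∑ j, (1 / 2) * (v j : ℂ) ^ 2) *
        ∏ u, Complex.exp (blockField L b t v (b u) * spin x u) := fun x => by
    rw [← Complex.exp_sum, ← Complex.exp_add, ← Complex.exp_add, add_assoc]
    congr 2
    rw [inner_scaledMagnetization]
    push_cast
    simp only [Finset.sum_mul]
    rw [Finset.sum_comm, ← Finset.sum_add_distrib]
    refine Finset.sum_congr rfl fun u _ => ?_
    rw [blockField]
    push_cast
    rw [add_mul, Finset.sum_div, Finset.sum_mul]
    congr 1
    · exact Finset.sum_congr rfl fun j _ => by ring
    · ring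
  simp only [h2]
  rw [← Finset.mul_sum, sum_prod_exp_spin, Finset.prod_mul_distrib]
  have h3 : ∏ u, Complex.cosh (blockField L b t v (b u)) =
      ∏ i, Complex.cosh (blockField L b t v i) ^ (block b i).card := by
    rw [← Finset.prod_fiberwise (s := Finset.univ) (g := b)]
    refine Finset.prod_congr rfl fun i _ => ?_
    rw [← Finset.prod_const]
    refine Finset.prod_congr rfl fun u hu => ?_
    rw [(by simpa [block] using hu : b u = i)]
  rw [h3]
  simp
  ring

/-- The partition function is written as the numerator at `t = 0`, so that one asymptotic statement
serves both parts of the quotient. -/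
theorem charFun_map_scaledMagnetization {N k : ℕ} (A : Matrix (Fin k) (Fin k) ℝ)
    (b : Fin N → Fin k) (t : EuclideanSpace ℝ (Fin k)) :
    charFun ((isingMeasure (blockInteraction A b)).map (scaledMagnetization b)) t =
      (∑ x : SpinConfig (Fin N), Complex.exp (hamiltonian (blockInteraction A b) x) *
        Complex.exp (inner ℝ (scaledMagnetization b x) t * Complex.I)) /
      (∑ x : SpinConfig (Fin N), Complex.exp (hamiltonian (blockInteraction A b) x) *
        Complex.exp (inner ℝ (scaledMagnetization b x) 0 * Complex.I)) := by
  rw [charFun_apply, integral_map (Measurable.of_discrete).aemeasurable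
    (by fun_prop), isingMeasure, PMF.integral_eq_sum, Finset.sum_div]
  refine Finset.sum_congr rfl fun x _ => ?_
  have hZ : (∑ x : SpinConfig (Fin N), Complex.exp (hamiltonian (blockInteraction A b) x) *
        Complex.exp (inner ℝ (scaledMagnetization b x) 0 * Complex.I)) =
      ((partitionFunction (blockInteraction A b) : ℝ) : ℂ) := by
    simp [partitionFunction]
  rw [hZ, isingPMF, PMF.ofFintype_apply, ENNReal.toReal_ofReal
    (div_nonneg (Real.exp_pos _).le (partitionFunction_pos _).le), Complex.real_smul]
  push_cast
  ring

/-! ### Linear algebra of the limiting covariance -/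

theorem one_sub_posDef_of_opNorm_lt_one {k : ℕ} {C : Matrix (Fin k) (Fin k) ℝ}
    (hC : C.IsHermitian) (h : opNorm C < 1) : (1 - C).PosDef := by
  refine Matrix.PosDef.of_dotProduct_mulVec_pos (Matrix.isHermitian_one.sub hC) fun x hx => ?_
  have hx' : (WithLp.toLp 2 x : EuclideanSpace ℝ (Fin k)) ≠ 0 := by simpa using hx
  have h1 := Matrix.inner_toEuclideanCLM C (WithLp.toLp 2 x) (WithLp.toLp 2 x)
  have h2 := real_inner_le_norm (WithLp.toLp 2 x)
    (Matrix.toEuclideanCLM (n := Fin k) (𝕜 := ℝ) C (WithLp.toLp 2 x))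
  have h3 := (Matrix.toEuclideanCLM (n := Fin k) (𝕜 := ℝ) C).le_opNorm (WithLp.toLp 2 x)
  have h4 : x ⬝ᵥ x = ‖(WithLp.toLp 2 x : EuclideanSpace ℝ (Fin k))‖ ^ 2 := by
    rw [EuclideanSpace.real_norm_sq_eq]
    simp [dotProduct, sq]
  have h5 : 0 < ‖(WithLp.toLp 2 x : EuclideanSpace ℝ (Fin k))‖ := norm_pos_iff.2 hx'
  rw [Matrix.sub_mulVec, Matrix.one_mulVec, dotProduct_sub, star_trivial, h4]
  rw [h1] at h2
  simp only at h2
  have h6 := mul_le_mul_of_nonneg_left h3 h5.le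
  have h7 : opNorm C * ‖(WithLp.toLp 2 x : EuclideanSpace ℝ (Fin k))‖ ^ 2 <
      1 * ‖(WithLp.toLp 2 x : EuclideanSpace ℝ (Fin k))‖ ^ 2 :=
    mul_lt_mul_of_pos_right h (by positivity)
  rw [opNorm] at h7
  nlinarith

/-- A positive semidefinite matrix is `W * Wᵀ` for some `W` with orthogonal columns. -/
theorem exists_mul_transpose_eq {k : ℕ} {C : Matrix (Fin k) (Fin k) ℝ} (hC : C.PosSemidef) :
    ∃ (W : Matrix (Fin k) (Fin k) ℝ) (d : Fin k → ℝ),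
      W * W.transpose = C ∧ W.transpose * W = Matrix.diagonal d := by
  set U : Matrix (Fin k) (Fin k) ℝ := (hC.1.eigenvectorUnitary : Matrix (Fin k) (Fin k) ℝ)
  have hU : U.transpose * U = 1 := Unitary.coe_star_mul_self hC.1.eigenvectorUnitary
  have hs : C = U * Matrix.diagonal hC.1.eigenvalues * U.transpose := by
    have := hC.1.spectral_theorem
    rwa [Unitary.conjStarAlgAut_apply] at this
  have hd : ∀ i, √(hC.1.eigenvalues i) * √(hC.1.eigenvalues i) = hC.1.eigenvalues i := fun i =>
    Real.mul_self_sqrt (hC.eigenvalues_nonneg i)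
  refine ⟨U * Matrix.diagonal fun i => √(hC.1.eigenvalues i), hC.1.eigenvalues, ?_, ?_⟩
  · rw [Matrix.transpose_mul, Matrix.diagonal_transpose, Matrix.mul_assoc,
      ← Matrix.mul_assoc (Matrix.diagonal _), Matrix.diagonal_mul_diagonal]
    simp only [hd]
    rw [← Matrix.mul_assoc, ← hs]
  · rw [Matrix.transpose_mul, Matrix.diagonal_transpose, Matrix.mul_assoc,
      ← Matrix.mul_assoc U.transpose, hU, Matrix.one_mul, Matrix.diagonal_mul_diagonal]
    simp only [hd]

/-- The `j`-th column `w` of `W` is orthogonal to the others, so `W Wᵀ w = d j • w` with `d j =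
|w|²`. If `w ≠ 0`, positivity of the form at `w` reads `0 < d j * (1 - d j)`. -/
theorem diagonal_lt_one {k : ℕ} {W : Matrix (Fin k) (Fin k) ℝ} {d : Fin k → ℝ}
    (hd : W.transpose * W = Matrix.diagonal d) (hC : (1 - W * W.transpose).PosDef) (j : Fin k) :
    d j < 1 := by
  have hdj : d j = (W *ᵥ Pi.single j 1) ⬝ᵥ (W *ᵥ Pi.single j 1) := by
    have h := congrFun (congrFun hd j) j
    rw [Matrix.diagonal_apply_eq] at h
    rw [← h]
    simp [Matrix.mul_apply, dotProduct]
  have h0 : 0 ≤ d j := by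
    rw [hdj]; exact Finset.sum_nonneg fun i _ => mul_self_nonneg _
  rcases h0.eq_or_lt with h | h
  · rw [← h]; exact one_pos
  have hw : W *ᵥ Pi.single j 1 ≠ 0 := fun hw => by
    rw [hw, dotProduct_zero] at hdj; exact h.ne' hdj
  have h1 := hC.dotProduct_mulVec_pos hw
  have h2 : (W * W.transpose) *ᵥ (W *ᵥ Pi.single j 1) = d j • (W *ᵥ Pi.single j 1) := by
    rw [Matrix.mulVec_mulVec, Matrix.mul_assoc, hd, ← Matrix.mulVec_mulVec,
      Matrix.diagonal_mulVec_single, ← Matrix.mulVec_smul, ← Pi.single_smul]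
    simp
  rw [Matrix.sub_mulVec, h2, Matrix.one_mulVec, dotProduct_sub, star_trivial, dotProduct_smul,
    ← hdj, smul_eq_mul] at h1
  nlinarith

/-- This is the identity `(1 - W Wᵀ)⁻¹ = 1 + W (1 - Wᵀ W)⁻¹ Wᵀ`, checked by multiplying out with `1
/ (1 - d) = 1 + d / (1 - d)`. -/
theorem inv_one_sub_mul_transpose {k : ℕ} {W : Matrix (Fin k) (Fin k) ℝ} {d : Fin k → ℝ}
    (hd : W.transpose * W = Matrix.diagonal d) (hlt : ∀ j, d j < 1) :
    (1 - W * W.transpose)⁻¹ =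
      1 + W * Matrix.diagonal (fun j => (1 - d j)⁻¹) * W.transpose := by
  refine Matrix.inv_eq_right_inv ?_
  have h1 : W * W.transpose * (W * Matrix.diagonal (fun j => (1 - d j)⁻¹) * W.transpose) =
      W * Matrix.diagonal (fun j => d j * (1 - d j)⁻¹) * W.transpose := by
    rw [← Matrix.diagonal_mul_diagonal, ← hd]
    simp only [Matrix.mul_assoc]
  have h2 : W * W.transpose = W * Matrix.diagonal (fun _ => (1 : ℝ)) * W.transpose := by
    rw [Matrix.diagonal_one, Matrix.mul_one]
  rw [Matrix.sub_mul, Matrix.one_mul, mul_add, Matrix.mul_one, h1]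
  rw [h2]
  have h3 : Matrix.diagonal (fun j => (1 - d j)⁻¹) = Matrix.diagonal (fun _ => (1 : ℝ)) +
      Matrix.diagonal (fun j => d j * (1 - d j)⁻¹) := by
    rw [Matrix.diagonal_add]
    congr 1; ext j
    have : 1 - d j ≠ 0 := (sub_pos.2 (hlt j)).ne'
    field_simp
    ring
  nth_rewrite 1 [h3]
  rw [mul_add, add_mul]
  abel

theorem dotProduct_inv_one_sub {k : ℕ} {W : Matrix (Fin k) (Fin k) ℝ} {d : Fin k → ℝ}
    (hd : W.transpose * W = Matrix.diagonal d) (hlt : ∀ j, d j < 1) (t : Fin k → ℝ) :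
    t ⬝ᵥ (1 - W * W.transpose)⁻¹ *ᵥ t =
      ∑ i, t i ^ 2 + ∑ j, (∑ i, t i * W i j) ^ 2 / (1 - d j) := by
  rw [inv_one_sub_mul_transpose hd hlt, Matrix.add_mulVec, Matrix.one_mulVec, dotProduct_add,
    ← Matrix.mulVec_mulVec, ← Matrix.mulVec_mulVec, Matrix.dotProduct_mulVec,
    Matrix.mulVec_transpose]
  congr 1
  · simp [dotProduct, sq]
  · simp only [dotProduct, Matrix.mulVec_diagonal]
    refine Finset.sum_congr rfl fun j _ => ?_
    simp only [Matrix.vecMul, dotProduct]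
    ring

theorem sum_sq_mulVec {k : ℕ} {W : Matrix (Fin k) (Fin k) ℝ} {d : Fin k → ℝ}
    (hd : W.transpose * W = Matrix.diagonal d) (v : Fin k → ℝ) :
    ∑ i, (∑ j, W i j * v j) ^ 2 = ∑ j, d j * v j ^ 2 := by
  have h : (W *ᵥ v) ⬝ᵥ (W *ᵥ v) = v ⬝ᵥ (Matrix.diagonal d *ᵥ v) := by
    rw [← hd, ← Matrix.mulVec_mulVec, Matrix.dotProduct_mulVec v, Matrix.vecMul_transpose]
  simp only [dotProduct, Matrix.mulVec_diagonal] at h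
  simp only [Matrix.mulVec, dotProduct] at h
  simp only [sq, h]
  exact Finset.sum_congr rfl fun j _ => by ring

/-! ### Passage to the limit in the Gaussian integral -/

/-- The limiting Gaussian integral. -/
theorem integral_limit {k : ℕ} {W : Matrix (Fin k) (Fin k) ℝ} {d : Fin k → ℝ}
    (hd : W.transpose * W = Matrix.diagonal d) (hlt : ∀ j, d j < 1) (t : Fin k → ℝ) :
    ∫ v : Fin k → ℝ, Complex.exp (-∑ j, (1 / 2) * (v j : ℂ) ^ 2) *
      ∏ i, Complex.exp (((((∑ j, W i j * v j : ℝ)) : ℂ) + (t i : ℂ) * Complex.I) ^ 2 / 2) =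
    (∏ j, ((Real.pi : ℂ) / ((1 - d j) / 2)) ^ (1 / 2 : ℂ)) *
      Complex.exp (-((t ⬝ᵥ (1 - W * W.transpose)⁻¹ *ᵥ t : ℝ) : ℂ) / 2) := by
  -- Expanding the squares, `|W v|² / 2` merges with the Gaussian weight to give the coefficients
  -- `(1 - d j) / 2`, the cross terms form an imaginary linear term, and `-|t|² / 2` leaves the
  -- integral.
  have h1 : ∀ v : Fin k → ℝ, Complex.exp (-∑ j, (1 / 2) * (v j : ℂ) ^ 2) *
      ∏ i, Complex.exp (((((∑ j, W i j * v j : ℝ)) : ℂ) + (t i : ℂ) * Complex.I) ^ 2 / 2) =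
      Complex.exp (-∑ j, ((1 - d j) / 2 : ℂ) * (v j : ℂ) ^ 2 +
        ∑ j, (((∑ i, t i * W i j : ℝ) : ℂ) * Complex.I) * v j) *
        Complex.exp (-((∑ i, t i ^ 2 : ℝ) : ℂ) / 2) := fun v => by
    rw [← Complex.exp_sum, ← Complex.exp_add, ← Complex.exp_add]
    congr 1
    have e1 : ∀ i, ((((∑ j, W i j * v j : ℝ)) : ℂ) + (t i : ℂ) * Complex.I) ^ 2 / 2 =
        (((∑ j, W i j * v j) ^ 2 : ℝ) : ℂ) / 2 +
          (((∑ j, t i * W i j * v j : ℝ) : ℂ) * Complex.I - ((t i ^ 2 : ℝ) : ℂ) / 2) := fun i => by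
      simp only [mul_assoc, ← Finset.mul_sum]
      push_cast
      ring_nf
      rw [Complex.I_sq]
      ring
    simp only [e1]
    rw [Finset.sum_add_distrib, Finset.sum_sub_distrib, ← Finset.sum_div, ← Finset.sum_div,
      ← Complex.ofReal_sum, ← Complex.ofReal_sum, ← Finset.sum_mul, ← Complex.ofReal_sum,
      sum_sq_mulVec hd, Finset.sum_comm]
    have e2 : ∑ j, (((∑ i, t i * W i j : ℝ) : ℂ) * Complex.I) * v j =
        ((∑ j, ∑ i, t i * W i j * v j : ℝ) : ℂ) * Complex.I := by
      simp only [← Finset.sum_mul]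
      push_cast
      rw [Finset.sum_mul]
      exact Finset.sum_congr rfl fun j _ => by ring
    have e3 : -∑ j, ((1 - d j) / 2 : ℂ) * (v j : ℂ) ^ 2 =
        -∑ j, (1 / 2) * (v j : ℂ) ^ 2 + ((∑ j, d j * v j ^ 2 : ℝ) : ℂ) / 2 := by
      push_cast
      rw [Finset.sum_div, ← Finset.sum_neg_distrib, ← Finset.sum_neg_distrib,
        ← Finset.sum_add_distrib]
      exact Finset.sum_congr rfl fun j _ => by ring
    rw [e2, e3]
    ring
  have hb : ∀ j, 0 < ((1 - d j) / 2 : ℂ).re := fun j => by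
    have : ((1 - d j) / 2 : ℂ) = (((1 - d j) / 2 : ℝ) : ℂ) := by push_cast; ring
    rw [this, Complex.ofReal_re]
    linarith [hlt j]
  simp only [h1]
  rw [integral_mul_const, GaussianFourier.integral_cexp_neg_sum_mul_add hb,
    Finset.prod_mul_distrib, mul_assoc, ← Complex.exp_sum, ← Complex.exp_add,
    dotProduct_inv_one_sub hd hlt]
  congr 2
  push_cast
  rw [neg_add, add_div, add_comm]
  congr 1
  rw [neg_div, Finset.sum_div, ← Finset.sum_neg_distrib]
  refine Finset.sum_congr rfl fun j _ => ?_
  have : (1 - d j : ℂ) ≠ 0 := by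
    rw [← Complex.ofReal_one, ← Complex.ofReal_sub]
    exact Complex.ofReal_ne_zero.2 (sub_pos.2 (hlt j)).ne'
  rw [mul_pow, Complex.I_sq]
  field_simp
  ring

theorem tendsto_card_block {k : ℕ} {N : ℕ → ℕ} (hN : StrictMono N)
    {b : (n : ℕ) → Fin (N n) → Fin k} {i : Fin k} {g : ℝ} (hg : 0 < g)
    (h : Tendsto (fun n => √(((block (b n) i).card : ℝ) / (N n : ℝ))) atTop (𝓝 g)) :
    Tendsto (fun n => (block (b n) i).card) atTop atTop := by
  rw [← tendsto_natCast_atTop_iff (R := ℝ)]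
  have h1 := (h.pow 2).pos_mul_atTop (pow_pos hg 2)
    (tendsto_natCast_atTop_atTop.comp hN.tendsto_atTop)
  refine h1.congr' ?_
  filter_upwards [hN.tendsto_atTop.eventually_gt_atTop 0] with n hn
  have hn' : (N n : ℝ) ≠ 0 := Nat.cast_ne_zero.2 hn.ne'
  rw [Real.sq_sqrt (by positivity), Function.comp_apply, div_mul_cancel₀ _ hn']

theorem blockField_re {N k : ℕ} (L : Matrix (Fin k) (Fin k) ℝ) (b : Fin N → Fin k)
    (t : EuclideanSpace ℝ (Fin k)) (v : Fin k → ℝ) (i : Fin k) :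
    (blockField L b t v i).re = (∑ j, L i j * v j) / √(N : ℝ) := by
  rw [blockField, Complex.add_re, Complex.re_ofReal_mul, Complex.I_re, mul_zero, add_zero,
    Complex.ofReal_re]

theorem continuous_blockField {N k : ℕ} (L : Matrix (Fin k) (Fin k) ℝ) (b : Fin N → Fin k)
    (t : EuclideanSpace ℝ (Fin k)) (i : Fin k) : Continuous fun v => blockField L b t v i := by
  unfold blockField
  fun_prop

/-- Only the real part of the field enters the bound, so `t` drops out and the dependence on the
partition is through the proportions `|B_i| / N` alone. -/
theorem norm_prod_cosh_blockField_le {N k : ℕ} (L : Matrix (Fin k) (Fin k) ℝ)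
    (b : Fin N → Fin k) (t : EuclideanSpace ℝ (Fin k)) (v : Fin k → ℝ) :
    ‖∏ i, Complex.cosh (blockField L b t v i) ^ (block b i).card‖ ≤
      Real.exp (∑ i, ((block b i).card / (N : ℝ)) * (∑ j, L i j * v j) ^ 2 / 2) := by
  rw [norm_prod, Real.exp_sum]
  refine Finset.prod_le_prod (fun _ _ => norm_nonneg _) fun i _ => ?_
  rw [norm_pow]
  refine (pow_le_pow_left₀ (norm_nonneg _) (norm_cosh_le_exp _) _).trans_eq ?_
  rw [← Real.exp_nat_mul, blockField_re, div_pow, Real.sq_sqrt (Nat.cast_nonneg _)]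
  congr 1
  ring

theorem tendsto_integral_prod_cosh {k : ℕ} {W : Matrix (Fin k) (Fin k) ℝ} {d : Fin k → ℝ}
    (hd : W.transpose * W = Matrix.diagonal d) (hlt : ∀ j, d j < 1)
    {N : ℕ → ℕ} (hN : StrictMono N) {b : (n : ℕ) → Fin (N n) → Fin k}
    {γ : Fin k → ℝ} (hγ_pos : ∀ i, 0 < γ i)
    (hγ : ∀ i, Tendsto (fun n => √(((block (b n) i).card : ℝ) / (N n : ℝ))) atTop (𝓝 (γ i)))
    {L : Matrix (Fin k) (Fin k) ℝ} (hL : ∀ i j, γ i * L i j = W i j)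
    (t : EuclideanSpace ℝ (Fin k)) :
    Tendsto (fun n => ∫ v : Fin k → ℝ, Complex.exp (-∑ j, (1 / 2) * (v j : ℂ) ^ 2) *
      ∏ i, Complex.cosh (blockField L (b n) t v i) ^ (block (b n) i).card) atTop
    (𝓝 ((∏ j, ((Real.pi : ℂ) / ((1 - d j) / 2)) ^ (1 / 2 : ℂ)) *
      Complex.exp (-((t.ofLp ⬝ᵥ (1 - W * W.transpose)⁻¹ *ᵥ t.ofLp : ℝ) : ℂ) / 2))) := by
  rw [← integral_limit hd hlt]
  have hLv : ∀ (v : Fin k → ℝ) i, γ i * ∑ j, L i j * v j = ∑ j, W i j * v j := fun v i => by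
    rw [Finset.mul_sum]
    exact Finset.sum_congr rfl fun j _ => by rw [← hL]; ring
  -- The proportions `|B_i| / N` may exceed their limits `γ i ^ 2`, but eventually stay below `r * γ
  -- i ^ 2` for any `r > 1`. Taking `r` close to `1` keeps `r * d j < 1`, so the majorant with
  -- coefficients `(1 - r * d j) / 2` is integrable.
  obtain ⟨r, hr, hr1⟩ : ∃ r : ℝ, (∀ j, r * d j < 1) ∧ 1 < r := by
    have h1 : ∀ᶠ r : ℝ in 𝓝[>] 1, ∀ j, r * d j < 1 := by
      refine eventually_all.2 fun j => nhdsWithin_le_nhds ?_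
      have : Tendsto (fun r : ℝ => r * d j) (𝓝 1) (𝓝 (1 * d j)) := tendsto_id.mul_const _
      rw [one_mul] at this
      exact this.eventually_lt_const (hlt j)
    exact (h1.and self_mem_nhdsWithin).exists
  have hb : ∀ j, 0 < (((1 - r * d j) / 2 : ℝ) : ℂ).re := fun j => by
    rw [Complex.ofReal_re]; linarith [hr j]
  have hint : Integrable fun v : Fin k → ℝ => Complex.exp
      (-∑ j, (((1 - r * d j) / 2 : ℝ) : ℂ) * (v j : ℂ) ^ 2 + ∑ j, (0 : ℂ) * v j) :=
    GaussianFourier.integrable_cexp_neg_sum_mul_add hb _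
  refine tendsto_integral_filter_of_dominated_convergence _ ?_ ?_ hint.norm ?_
  · refine Eventually.of_forall fun n => Continuous.aestronglyMeasurable ?_
    have := fun i => continuous_blockField L (b n) t i
    have hc := fun i => (Complex.continuous_cosh.comp (this i)).pow (block (b n) i).card
    exact Continuous.mul (by fun_prop) (continuous_finsetProd _ fun i _ => hc i)
  · have hev : ∀ᶠ n in atTop, ∀ i, ((block (b n) i).card : ℝ) / (N n : ℝ) ≤ r * γ i ^ 2 := by
      refine eventually_all.2 fun i => ?_
      have h2 : γ i ^ 2 < r * γ i ^ 2 := lt_mul_of_one_lt_left (pow_pos (hγ_pos i) 2) hr1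
      filter_upwards [((hγ i).pow 2).eventually_lt_const h2] with n hn
      rw [Real.sq_sqrt (by positivity)] at hn
      exact hn.le
    filter_upwards [hev] with n hn
    refine ae_of_all _ fun v => ?_
    have e1 : (-∑ j, (1 / 2) * (v j : ℂ) ^ 2) = ((-∑ j, (1 / 2) * (v j) ^ 2 : ℝ) : ℂ) := by
      push_cast; rfl
    have e2 : (-∑ j, (((1 - r * d j) / 2 : ℝ) : ℂ) * (v j : ℂ) ^ 2 + ∑ j, (0 : ℂ) * v j) =
        ((-∑ j, ((1 - r * d j) / 2) * (v j) ^ 2 : ℝ) : ℂ) := by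
      simp
    rw [norm_mul, e1, e2, Complex.norm_exp_ofReal, Complex.norm_exp_ofReal]
    refine (mul_le_mul_of_nonneg_left (norm_prod_cosh_blockField_le L (b n) t v)
      (Real.exp_pos _).le).trans ?_
    rw [← Real.exp_add]
    refine Real.exp_le_exp.2 ?_
    have h3 : ∑ i, ((block (b n) i).card / (N n : ℝ)) * (∑ j, L i j * v j) ^ 2 / 2 ≤
        r / 2 * ∑ j, d j * v j ^ 2 := by
      rw [← sum_sq_mulVec hd, Finset.mul_sum]
      refine Finset.sum_le_sum fun i _ => ?_
      rw [← hLv, mul_pow]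
      nlinarith [mul_le_mul_of_nonneg_right (hn i) (sq_nonneg (∑ j, L i j * v j))]
    have h4 : -∑ j, ((1 - r * d j) / 2) * (v j) ^ 2 =
        -∑ j, (1 / 2) * (v j) ^ 2 + r / 2 * ∑ j, d j * v j ^ 2 := by
      rw [Finset.mul_sum, ← Finset.sum_neg_distrib, ← Finset.sum_neg_distrib,
        ← Finset.sum_add_distrib]
      exact Finset.sum_congr rfl fun j _ => by ring
    rw [h4]
    linarith
  · refine ae_of_all _ fun v => Tendsto.const_mul _ (tendsto_finsetProd _ fun i _ => ?_)
    have hcard := tendsto_card_block hN (hγ_pos i) (hγ i)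
    refine tendsto_cosh_pow hcard ?_
    have h5 : Tendsto (fun n => ((√(((block (b n) i).card : ℝ) / (N n : ℝ)) *
        ∑ j, L i j * v j : ℝ) : ℂ) + (t i : ℂ) * Complex.I) atTop
        (𝓝 (((∑ j, W i j * v j : ℝ) : ℂ) + (t i : ℂ) * Complex.I)) := by
      rw [← hLv]
      exact ((Complex.continuous_ofReal.tendsto _).comp ((hγ i).mul_const _)).add_const _
    refine h5.congr' ?_
    -- The block must be nonempty for `√|B_i|` to cancel in the imaginary part.
    filter_upwards [hcard.eventually_gt_atTop 0] with n hn
    have hn' : √((block (b n) i).card : ℝ) ≠ 0 := (Real.sqrt_pos.2 (Nat.cast_pos.2 hn)).ne'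
    rw [blockField, mul_add, ← mul_assoc, ← Complex.ofReal_mul, ← Complex.ofReal_mul,
      Real.sqrt_div (Nat.cast_nonneg _), mul_div_cancel₀ _ hn']
    congr 2
    ring

/-! ### The central limit theorem and the uniform case -/

/-- Central limit theorem for the block magnetization at strictly high temperature. -/
theorem tendstoInDistribution_scaledMagnetization {k : ℕ} {A : Matrix (Fin k) (Fin k) ℝ}
    (hA : A.PosDef) {N : ℕ → ℕ} (hN : StrictMono N) {b : (n : ℕ) → Fin (N n) → Fin k}
    {γ : Fin k → ℝ} (hγ_pos : ∀ i, 0 < γ i)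
    (hγ : ∀ i, Tendsto (fun n => √(((block (b n) i).card : ℝ) / (N n : ℝ))) atTop (𝓝 (γ i)))
    (hC : (1 - Matrix.diagonal γ * A * Matrix.diagonal γ).PosDef) :
    TendstoInDistribution (fun n => scaledMagnetization (b n)) atTop id
      (fun n => isingMeasure (blockInteraction A (b n)))
      (multivariateGaussian 0 (1 - Matrix.diagonal γ * A * Matrix.diagonal γ)⁻¹) := by
  have hpsd : (Matrix.diagonal γ * A * Matrix.diagonal γ).PosSemidef := by
    have := hA.posSemidef.mul_mul_conjTranspose_same (Matrix.diagonal γ)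
    rwa [Matrix.diagonal_conjTranspose, star_trivial] at this
  obtain ⟨W, d, hW, hd⟩ := exists_mul_transpose_eq hpsd
  rw [← hW] at hC
  have hlt := fun j => diagonal_lt_one hd hC j
  have hγinv : Matrix.diagonal (fun i => (γ i)⁻¹) * Matrix.diagonal γ = 1 := by
    rw [Matrix.diagonal_mul_diagonal, ← Matrix.diagonal_one]
    congr 1; ext i; exact inv_mul_cancel₀ (hγ_pos i).ne'
  have hγinv' : Matrix.diagonal γ * Matrix.diagonal (fun i => (γ i)⁻¹) = 1 := by
    rw [Matrix.diagonal_mul_diagonal, ← Matrix.diagonal_one]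
    congr 1; ext i; exact mul_inv_cancel₀ (hγ_pos i).ne'
  -- The square root of `A` is adapted to the limit: `Γ L = W` has orthogonal columns and still `L
  -- Lᵀ = Γ⁻¹ (Γ A Γ) Γ⁻¹ = A`.
  set L : Matrix (Fin k) (Fin k) ℝ := Matrix.diagonal (fun i => (γ i)⁻¹) * W with hLdef
  have hLA : L * L.transpose = A := by
    rw [hLdef, Matrix.transpose_mul, Matrix.diagonal_transpose, Matrix.mul_assoc,
      ← Matrix.mul_assoc W, hW]
    calc _ = (Matrix.diagonal (fun i => (γ i)⁻¹) * Matrix.diagonal γ) * A *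
          (Matrix.diagonal γ * Matrix.diagonal (fun i => (γ i)⁻¹)) := by
          simp only [Matrix.mul_assoc]
      _ = A := by rw [hγinv, hγinv', Matrix.one_mul, Matrix.mul_one]
  have hL : ∀ i j, γ i * L i j = W i j := fun i j => by
    rw [hLdef, Matrix.diagonal_mul, mul_inv_cancel_left₀ (hγ_pos i).ne']
  rw [← hW]
  refine ⟨fun n => (Measurable.of_discrete).aemeasurable, measurable_id.aemeasurable, ?_⟩
  refine ProbabilityMeasure.tendsto_iff_tendsto_charFun.2 fun t => ?_
  simp only [ProbabilityMeasure.coe_mk, Measure.map_id]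
  rw [charFun_multivariateGaussian hC.inv.posSemidef]
  have ht := tendsto_integral_prod_cosh hd hlt hN hγ_pos hγ hL t
  have h0 := tendsto_integral_prod_cosh hd hlt hN hγ_pos hγ hL 0
  have hG : (∏ j, ((Real.pi : ℂ) / ((1 - d j) / 2)) ^ (1 / 2 : ℂ)) ≠ 0 := by
    refine Finset.prod_ne_zero_iff.2 fun j _ => ?_
    rw [Complex.cpow_ne_zero_iff]
    left
    have : (1 - d j : ℂ) ≠ 0 := by
      rw [← Complex.ofReal_one, ← Complex.ofReal_sub]
      exact Complex.ofReal_ne_zero.2 (sub_pos.2 (hlt j)).ne'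
    simp [Real.pi_ne_zero, this]
  have hdiv := ht.div h0 (mul_ne_zero hG (Complex.exp_ne_zero _))
  have hlim : ∀ z : ℂ, (∏ j, ((Real.pi : ℂ) / ((1 - d j) / 2)) ^ (1 / 2 : ℂ)) * z /
      ((∏ j, ((Real.pi : ℂ) / ((1 - d j) / 2)) ^ (1 / 2 : ℂ)) * 1) = z := fun z => by
    rw [mul_one, mul_div_cancel_left₀ _ hG]
  simp only [WithLp.ofLp_zero, zero_dotProduct, Complex.ofReal_zero, neg_zero, zero_div,
    Complex.exp_zero] at hdiv
  rw [hlim] at hdiv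
  simp only [inner_zero_right, Complex.ofReal_zero, zero_mul, zero_sub, ← neg_div]
  refine hdiv.congr fun n => Eq.symm ?_
  -- The factors `gaussianConst k` and `2 ^ N` do not depend on `t` and cancel in the quotient.
  rw [charFun_map_scaledMagnetization, ← hLA, ← mul_div_mul_left _ _ (gaussianConst_ne_zero k),
    sum_exp_hamiltonian_mul_exp_inner, sum_exp_hamiltonian_mul_exp_inner,
    mul_div_mul_left _ _ (pow_ne_zero _ two_ne_zero), Pi.div_apply]

theorem diagonal_const_mul_mul {k : ℕ} (A : Matrix (Fin k) (Fin k) ℝ) {γ : Fin k → ℝ}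
    (hγ : ∀ i, γ i = 1 / √(k : ℝ)) :
    Matrix.diagonal γ * A * Matrix.diagonal γ = (1 / (k : ℝ)) • A := by
  ext i j
  rw [Matrix.mul_diagonal, Matrix.diagonal_mul, hγ, hγ, Matrix.smul_apply, smul_eq_mul]
  have : 1 / (k : ℝ) = 1 / √(k : ℝ) * (1 / √(k : ℝ)) := by
    rw [div_mul_div_comm, Real.mul_self_sqrt (Nat.cast_nonneg _), one_mul]
  rw [this]; ring

theorem opNorm_smul {k : ℕ} {c : ℝ} (hc : 0 ≤ c) (A : Matrix (Fin k) (Fin k) ℝ) :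
    opNorm (c • A) = c * opNorm A := by
  rw [opNorm, map_smul, norm_smul, Real.norm_of_nonneg hc, opNorm]

theorem isHermitian_diagonal_mul_mul {k : ℕ} {A : Matrix (Fin k) (Fin k) ℝ}
    (hA : A.IsHermitian) (γ : Fin k → ℝ) :
    (Matrix.diagonal γ * A * Matrix.diagonal γ).IsHermitian := by
  have := Matrix.isHermitian_mul_mul_conjTranspose (Matrix.diagonal γ) hA
  rwa [Matrix.diagonal_conjTranspose, star_trivial] at this

end BlockSpin

theorem theorem1p3 {k : ℕ} (A : Matrix (Fin k) (Fin k) ℝ) (hA : A.PosDef)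
    (N : ℕ → ℕ) (hN : StrictMono N) (b : (n : ℕ) → Fin (N n) → Fin k)
    (γ : Fin k → ℝ) (hγ_pos : ∀ i, 0 < γ i)
    (hγ : ∀ i, Tendsto (fun n => √(((BlockSpin.block (b n) i).card : ℝ) / (N n : ℝ)))
      atTop (𝓝 (γ i))) :
    (BlockSpin.opNorm (Matrix.diagonal γ * A * Matrix.diagonal γ) < 1 →
      (1 - Matrix.diagonal γ * A * Matrix.diagonal γ).PosDef ∧
      TendstoInDistribution
        (fun n => BlockSpin.scaledMagnetization (b n)) atTop id
        (fun n => BlockSpin.isingMeasure (BlockSpin.blockInteraction A (b n)))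
        (multivariateGaussian 0 (1 - Matrix.diagonal γ * A * Matrix.diagonal γ)⁻¹)) ∧
    ((∀ i, γ i = 1 / √(k : ℝ)) → BlockSpin.opNorm A < (k : ℝ) →
      (1 - (1 / (k : ℝ)) • A).PosDef ∧
      TendstoInDistribution
        (fun n => BlockSpin.scaledMagnetization (b n)) atTop id
        (fun n => BlockSpin.isingMeasure (BlockSpin.blockInteraction A (b n)))
        (multivariateGaussian 0 (1 - (1 / (k : ℝ)) • A)⁻¹)) := by
  have high : BlockSpin.opNorm (Matrix.diagonal γ * A * Matrix.diagonal γ) < 1 →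
      (1 - Matrix.diagonal γ * A * Matrix.diagonal γ).PosDef ∧
      TendstoInDistribution
        (fun n => BlockSpin.scaledMagnetization (b n)) atTop id
        (fun n => BlockSpin.isingMeasure (BlockSpin.blockInteraction A (b n)))
        (multivariateGaussian 0 (1 - Matrix.diagonal γ * A * Matrix.diagonal γ)⁻¹) := fun h => by
    have hC := BlockSpin.one_sub_posDef_of_opNorm_lt_one
      (BlockSpin.isHermitian_diagonal_mul_mul hA.1 γ) h
    exact ⟨hC, BlockSpin.tendstoInDistribution_scaledMagnetization hA hN hγ_pos hγ hC⟩
  refine ⟨high, fun hunif h => ?_⟩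
  -- Positivity of `k` follows from `0 ≤ ‖A‖ < k`.
  have hk : 0 < (k : ℝ) := (norm_nonneg _).trans_lt h
  rw [BlockSpin.diagonal_const_mul_mul A hunif] at high
  refine high ?_
  rw [BlockSpin.opNorm_smul (one_div_nonneg.2 hk.le), one_div, inv_mul_lt_iff₀ hk, mul_one]
  exact h
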